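/- Let $n\ge 0$ be an integer and let $M_n$ be the algebra of complex $n\times n$ matrices. Call a linear map $\phi : M_p \to M_q$ \emph{PPT} if both $\phi$ and $T\circ\phi$ are completely positive, where $T : M_q \to M_q$ is the transpose map. Call $\phi$ \emph{entanglement breaking} if, for every $k$ and every positive semidefinite $X \in M_k\otimes M_p$, the matrix $(\mathrm{id}_k\otimes\phi)(X)\in M_k\otimes M_q$ is separable, i.e. a finite sum $\sum_i P_i\otimes Q_i$ with $P_i\in M_k$ and $Q_i\in M_q$ positive semidefinite. Let $\phi : M_n \to M_n$ be a linear map that is idempotent ($\phi\circ\phi=\phi$), unital ($\phi(I)=I$) and PPT. Then $\phi$ is entanglement breaking. -/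

import Mathlib

namespace PPT

section CP

open scoped MatrixOrder Matrix.Norms.L2Operator

/-- A linear map `φ : M_p → M_q` is completely positive: it is the underlying linear map of a
completely positive map between the C⋆-algebras `M_p` and `M_q` of complex matrices (with the
operator norm and the order in which the nonnegative elements are the positive semidefinite
matrices). -/
def IsCompletelyPositive {p q : ℕ}
    (φ : Matrix (Fin p) (Fin p) ℂ →ₗ[ℂ] Matrix (Fin q) (Fin q) ℂ) : Prop :=
  ∃ Φ : CompletelyPositiveMap (Matrix (Fin p) (Fin p) ℂ) (Matrix (Fin q) (Fin q) ℂ),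
    Φ.toLinearMap = φ

end CP

/-- The transpose map `T : M_q → M_q`. -/
def transposeMap (q : ℕ) : Matrix (Fin q) (Fin q) ℂ →ₗ[ℂ] Matrix (Fin q) (Fin q) ℂ :=
  (Matrix.transposeLinearEquiv (Fin q) (Fin q) ℂ ℂ).toLinearMap

/-- `φ` is PPT: it is completely positive, and so is its composition with the transpose map on the
range space. -/
def IsPPT {p q : ℕ}
    (φ : Matrix (Fin p) (Fin p) ℂ →ₗ[ℂ] Matrix (Fin q) (Fin q) ℂ) : Prop :=
  IsCompletelyPositive φ ∧ IsCompletelyPositive (transposeMap q ∘ₗ φ)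

/-- The ampliation `id_k ⊗ φ : M_k ⊗ M_p → M_k ⊗ M_q`, where `M_k ⊗ M_p` is the algebra of
matrices indexed by pairs: `φ` is applied to each of the `k × k` blocks of size `p × p`. -/
def ampliation {p q : ℕ} (k : ℕ)
    (φ : Matrix (Fin p) (Fin p) ℂ →ₗ[ℂ] Matrix (Fin q) (Fin q) ℂ)
    (X : Matrix (Fin k × Fin p) (Fin k × Fin p) ℂ) :
    Matrix (Fin k × Fin q) (Fin k × Fin q) ℂ :=
  Matrix.comp (Fin k) (Fin k) (Fin q) (Fin q) ℂ
    (((Matrix.comp (Fin k) (Fin k) (Fin p) (Fin p) ℂ).symm X).map φ)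

open scoped Kronecker ComplexOrder in
/-- An element of `M_k ⊗ M_q` is separable if it is a finite sum of tensor products of positive
semidefinite matrices (no normalization of the trace is imposed). -/
def IsSeparable {k q : ℕ} (S : Matrix (Fin k × Fin q) (Fin k × Fin q) ℂ) : Prop :=
  ∃ (m : ℕ) (P : Fin m → Matrix (Fin k) (Fin k) ℂ) (Q : Fin m → Matrix (Fin q) (Fin q) ℂ),
    (∀ i, (P i).PosSemidef) ∧ (∀ i, (Q i).PosSemidef) ∧ S = ∑ i, P i ⊗ₖ Q i

open scoped ComplexOrder in
/-- `φ` is entanglement breaking: for every `k`, the ampliation `id_k ⊗ φ` maps every positive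
semidefinite element of `M_k ⊗ M_p` (equivalently, every state, up to scaling) to a separable
element of `M_k ⊗ M_q`. -/
def IsEntanglementBreaking {p q : ℕ}
    (φ : Matrix (Fin p) (Fin p) ℂ →ₗ[ℂ] Matrix (Fin q) (Fin q) ℂ) : Prop :=
  ∀ (k : ℕ) (X : Matrix (Fin k × Fin p) (Fin k × Fin p) ℂ),
    X.PosSemidef → IsSeparable (ampliation k φ X)

end PPT

namespace PPT

/-! ### Kadison–Schwarz inequality for unital completely positive maps. -/

section Schwarz

variable {A B : Type*} [CStarAlgebra A] [PartialOrder A] [StarOrderedRing A]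
  [CStarAlgebra B] [PartialOrder B] [StarOrderedRing B]

/-! The range of a unital completely positive idempotent `φ` is an algebra under the Choi–Effros
product `φ (x * y)`. The Schwarz inequality for the transposed map gives `φ x * star (φ x) ≤ φ (star
x * x)`; on fixed points, applying `φ` and exchanging `x` with `star x` gives `φ (x * star x) = φ
(star x * x)`, and polarization makes the product commutative (`map_mul_comm`). The range is then a
reduced finite-dimensional commutative algebra, hence a power of ℂ. Its minimal idempotents `p i`
and characters are positive, so `φ = ∑ i, f i • p i` with positive functionals `f i`
(`exists_positive_decomposition`), and `id ⊗ φ` sends `X` to `∑ i, (id ⊗ f i) X ⊗ p i`, which is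
separable. -/

theorem _root_.CStarMatrix.diag_nonneg {m : Type*} [Fintype m] {M : CStarMatrix m m A}
    (hM : 0 ≤ M) (i : m) : 0 ≤ M i i := by
  rw [StarOrderedRing.nonneg_iff] at hM
  induction hM using AddSubmonoid.closure_induction with
  | mem x hx =>
    obtain ⟨N, rfl⟩ := hx
    change 0 ≤ (star N * N) i i
    rw [CStarMatrix.mul_apply]
    exact Finset.sum_nonneg fun j _ => by
      rw [CStarMatrix.star_apply]; exact star_mul_self_nonneg _
  | zero => exact le_rfl
  | add x y _ _ hx hy => exact add_nonneg hx hy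

/-- Apply `Φ` entrywise to `[[x⋆x, x⋆], [x, 1]] ≥ 0` and compress the result to the column `(1, -Φ
x)`. -/
theorem _root_.CompletelyPositiveMap.star_mul_self_le (Φ : CompletelyPositiveMap A B)
    (h1 : Φ 1 = 1) (x : A) : star (Φ x) * Φ x ≤ Φ (star x * x) := by
  let M : CStarMatrix (Fin 2) (Fin 2) A := CStarMatrix.ofMatrix !![x, 1; 0, 0]
  have hM : 0 ≤ (star M * M).map Φ := Φ.map_cstarMatrix_nonneg' 2 _ (star_mul_self_nonneg M)
  let V : CStarMatrix (Fin 2) (Fin 2) B := CStarMatrix.ofMatrix !![1, 0; -Φ x, 0]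
  have h := CStarMatrix.diag_nonneg (star_left_conjugate_nonneg hM V) 0
  have hs : Φ (star x) = star (Φ x) := map_star Φ x
  simpa [CStarMatrix.mul_apply, Fin.sum_univ_two, M, V, h1, hs, CStarMatrix.star_apply] using h

end Schwarz

/-! ### The Choi–Effros product. -/

section Projection

variable {A : Type*} [CStarAlgebra A] [PartialOrder A] [StarOrderedRing A]

/-- A unital, star-preserving, idempotent linear map satisfying the Schwarz inequality. -/
structure IsSchwarzProjection (φ : A →ₗ[ℂ] A) : Prop where
  map_one : φ 1 = 1
  map_star : ∀ x, φ (star x) = star (φ x)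
  idem : ∀ x, φ (φ x) = φ x
  schwarz : ∀ x, star (φ x) * φ x ≤ φ (star x * x)

/-- For `t = s u` with `s → 0⁺` the linear term dominates; replacing `u` by `-u` kills it, and `u =
1, I` separate `D` from `star D`. -/
theorem eq_zero_of_forall_nonneg {C D : A}
    (h : ∀ t : ℂ, 0 ≤ t • star D + star t • D + (star t * t) • C) : D = 0 := by
  have key (u : ℂ) : 0 ≤ u • star D + star u • D := by
    have hlim : Filter.Tendsto (fun s : ℝ => u • star D + star u • D + ((s : ℂ) * (star u * u)) • C)
        (nhdsWithin 0 (Set.Ioi 0)) (nhds (u • star D + star u • D)) := by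
      have : Continuous fun s : ℝ =>
          u • star D + star u • D + ((s : ℂ) * (star u * u)) • C := by fun_prop
      simpa using (this.tendsto 0).mono_left nhdsWithin_le_nhds
    refine ge_of_tendsto hlim ?_
    filter_upwards [self_mem_nhdsWithin] with s hs
    have hs : 0 < s := hs
    have h2 := smul_nonneg (inv_nonneg.mpr hs.le) (h (s * u))
    have hs' : (s : ℂ) ≠ 0 := by exact_mod_cast hs.ne'
    convert h2 using 1
    rw [← Complex.coe_smul]
    simp only [smul_add, smul_smul, star_mul', Complex.star_def, Complex.conj_ofReal,
      Complex.ofReal_inv]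
    congr 2 <;> field_simp
  have hz (u : ℂ) : u • star D + star u • D = 0 := by
    refine le_antisymm ?_ (key u)
    have := key (-u)
    rw [star_neg, neg_smul, neg_smul, ← neg_add] at this
    exact neg_nonneg.mp this
  have h1 := hz 1
  have h2 := hz Complex.I
  simp only [one_smul, star_one, Complex.star_def, Complex.conj_I, neg_smul,
    ← sub_eq_add_neg, ← smul_sub, smul_eq_zero, Complex.I_ne_zero, false_or] at h1 h2
  rw [sub_eq_zero.mp h2, ← two_smul ℂ] at h1
  simpa using h1

namespace IsSchwarzProjection

variable {φ : A →ₗ[ℂ] A}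

theorem map_nonneg (h : IsSchwarzProjection φ) {x : A} (hx : 0 ≤ x) : 0 ≤ φ x := by
  obtain ⟨y, rfl⟩ := CStarAlgebra.nonneg_iff_eq_star_mul_self.mp hx
  exact (star_mul_self_nonneg _).trans (h.schwarz y)

theorem map_mono (h : IsSchwarzProjection φ) {x y : A} (hxy : x ≤ y) : φ x ≤ φ y := by
  have := h.map_nonneg (sub_nonneg.mpr hxy)
  rwa [map_sub, sub_nonneg] at this

theorem map_mul_eq_zero (h : IsSchwarzProjection φ) {z y : A} (hz : φ z = 0) (hy : φ y = y) :
    φ (z * y) = 0 := by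
  refine eq_zero_of_forall_nonneg (C := φ (z * star z)) fun t => ?_
  -- `φ` sends `y + t • star z` to `y`, so Schwarz followed by `φ` bounds `φ (star y * y)` for every
  -- `t`.
  have h1 := h.map_mono (h.schwarz (y + t • star z))
  have h2 : φ (y + t • star z) = y := by simp [h.map_star, hz, hy]
  rw [h2, h.idem] at h1
  have h3 : φ (star (y + t • star z) * (y + t • star z)) = φ (star y * y) +
      (t • star (φ (z * y)) + star t • φ (z * y) + (star t * t) • φ (z * star z)) := by
    simp only [star_add, star_smul, star_star, add_mul, mul_add, smul_mul_assoc, mul_smul_comm,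
      map_add, map_smul, ← h.map_star, star_mul, mul_smul, smul_add, smul_comm t]
    abel
  rwa [h3, le_add_iff_nonneg_right] at h1

/-- The Choi–Effros identity. -/
theorem map_map_mul (h : IsSchwarzProjection φ) (x : A) {y : A} (hy : φ y = y) :
    φ (φ x * y) = φ (x * y) := by
  have := h.map_mul_eq_zero (z := φ x - x) (by simp [h.idem]) hy
  rwa [sub_mul, map_sub, sub_eq_zero] at this

theorem map_mul_map (h : IsSchwarzProjection φ) {x : A} (y : A) (hx : φ x = x) :
    φ (x * φ y) = φ (x * y) := by
  have := h.map_map_mul (star y) (y := star x) (by rw [h.map_star, hx])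
  rwa [h.map_star, ← star_mul, ← star_mul, h.map_star, h.map_star, star_inj] at this

theorem map_mul_comm (h : IsSchwarzProjection φ)
    (hle : ∀ x, φ x = x → φ (x * star x) ≤ φ (star x * x)) {x y : A}
    (hx : φ x = x) (hy : φ y = y) : φ (x * y) = φ (y * x) := by
  have heq (z : A) (hz : φ z = z) : φ (z * star z) = φ (star z * z) := by
    refine le_antisymm (hle z hz) ?_
    simpa using hle (star z) (by rw [h.map_star, hz])
  have hxs : φ (star x) = star x := by rw [h.map_star, hx]
  refine (sub_eq_zero.mp (eq_zero_of_forall_nonneg (C := 0) fun t => ?_)).symm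
  have h1 := heq (y + t • star x) (by simp [hxs, hy])
  simp only [star_add, star_smul, star_star, mul_add, add_mul, map_add, heq y hy,
    smul_mul_assoc, mul_smul_comm, map_smul, smul_add] at h1
  have h2 := heq (star x) hxs
  rw [star_star] at h2
  rw [h2, smul_comm t] at h1
  rw [star_sub, ← h.map_star, ← h.map_star, star_mul, star_mul, smul_zero, add_zero]
  refine le_of_eq ?_
  rw [← sub_eq_zero] at h1
  rw [← h1, smul_sub, smul_sub]
  abel

end IsSchwarzProjection
end Projection

/-! ### Reduced commutative algebras and the positive decomposition. -/

theorem exists_idempotents_characters (R : Type*) [CommRing R] [Algebra ℂ R]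
    [Module.Finite ℂ R] [IsReduced R] :
    ∃ (m : ℕ) (e : Fin m → R) (χ : Fin m → R →ₐ[ℂ] ℂ),
      (∀ i, e i ≠ 0 ∧ IsIdempotentElem (e i)) ∧ (∀ i a, a * e i = χ i a • e i) ∧
      ∀ a, a = ∑ i, χ i a • e i := by
  classical
  have : IsArtinianRing R := .of_finite ℂ R
  have := Fintype.ofFinite (MaximalSpectrum R)
  let E := IsArtinianRing.equivPi R
  have hb (I : MaximalSpectrum R) : Function.Bijective (algebraMap ℂ (R ⧸ I.asIdeal)) := by
    have := Ideal.Quotient.isDomain I.asIdeal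
    exact IsAlgClosed.algebraMap_bijective_of_isIntegral
  let c (I : MaximalSpectrum R) : R →ₐ[ℂ] ℂ :=
    ((AlgEquiv.ofBijective (Algebra.ofId ℂ (R ⧸ I.asIdeal)) (hb I)).symm : _ →ₐ[ℂ] ℂ).comp
      (Ideal.Quotient.mkₐ ℂ I.asIdeal)
  have hc (I : MaximalSpectrum R) (a : R) :
      algebraMap ℂ (R ⧸ I.asIdeal) (c I a) = Ideal.Quotient.mk I.asIdeal a :=
    (AlgEquiv.ofBijective (Algebra.ofId ℂ (R ⧸ I.asIdeal)) (hb I)).apply_symm_apply _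
  have hE (a : R) (I : MaximalSpectrum R) : E a I = Ideal.Quotient.mk I.asIdeal a := rfl
  have hEs (t : ℂ) (a : R) (I : MaximalSpectrum R) :
      E (t • a) I = algebraMap ℂ _ t * E a I := by
    rw [hE, hE, ← Algebra.smul_def]; rfl
  let e (I : MaximalSpectrum R) : R := E.symm (Pi.single I 1)
  have hEe (I : MaximalSpectrum R) : E (e I) = Pi.single I 1 := E.apply_symm_apply _
  have hmul (I : MaximalSpectrum R) (a : R) : a * e I = c I a • e I := by
    apply E.injective
    ext J
    rw [hEs, map_mul, Pi.mul_apply, hEe]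
    by_cases hJ : J = I
    · subst hJ; simp [hc, hE]
    · simp [Pi.single_eq_of_ne hJ]
  have hsum : ∑ I, e I = 1 := by
    apply E.injective
    rw [map_sum, map_one]
    simp only [hEe]
    exact Finset.univ_sum_single 1
  let σ := (Fintype.equivFin (MaximalSpectrum R)).symm
  refine ⟨Fintype.card (MaximalSpectrum R), fun i => e (σ i), fun i => c (σ i),
    fun i => ⟨fun h0 => ?_, ?_⟩, fun i a => hmul _ a, fun a => ?_⟩
  · have := congrFun (hEe (σ i)) (σ i)
    rw [show e (σ i) = 0 from h0] at this
    simp at this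
  · apply E.injective
    rw [map_mul, hEe, ← Pi.single_mul, one_mul]
  · rw [σ.sum_comp (fun I => c I a • e I)]
    simp only [← hmul]
    rw [← Finset.mul_sum, hsum, mul_one]

namespace IsSchwarzProjection

variable {A : Type*} [CStarAlgebra A] [PartialOrder A] [StarOrderedRing A] {φ : A →ₗ[ℂ] A}

/-- The Choi–Effros product on the range of a Schwarz projection, when it is commutative. -/
noncomputable abbrev commRing (h : IsSchwarzProjection φ)
    (hcomm : ∀ x y, φ x = x → φ y = y → φ (x * y) = φ (y * x)) :
    CommRing (LinearMap.range φ) :=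
  have hr (x : LinearMap.range φ) : φ x = x := by
    obtain ⟨_, y, rfl⟩ := x
    exact h.idem y
  { (inferInstance : AddCommGroup (LinearMap.range φ)) with
    mul := fun x y => ⟨φ (x * y), LinearMap.mem_range_self _ _⟩
    one := ⟨1, 1, h.map_one⟩
    mul_assoc := fun x y z => Subtype.ext <| by
      change φ (φ (x * y) * z) = φ (x * φ (y * z))
      rw [h.map_map_mul _ (hr z), h.map_mul_map _ (hr x), mul_assoc]
    mul_comm := fun x y => Subtype.ext <| hcomm x y (hr x) (hr y)
    one_mul := fun x => Subtype.ext <| show φ (1 * x) = x by rw [one_mul, hr]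
    mul_one := fun x => Subtype.ext <| show φ (x * 1) = x by rw [mul_one, hr]
    left_distrib := fun x y z => Subtype.ext <|
      show φ (x * (y + z)) = φ (x * y) + φ (x * z) by rw [mul_add, map_add]
    right_distrib := fun x y z => Subtype.ext <|
      show φ ((x + y) * z) = φ (x * z) + φ (y * z) by rw [add_mul, map_add]
    zero_mul := fun x => Subtype.ext <| show φ (0 * x) = 0 by rw [zero_mul, map_zero]
    mul_zero := fun x => Subtype.ext <| show φ (x * 0) = 0 by rw [mul_zero, map_zero] }

theorem eq_zero_of_map_star_mul_self (h : IsSchwarzProjection φ) {x : A} (hx : φ x = x)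
    (h0 : φ (star x * x) = 0) : x = 0 := by
  have := h.schwarz x
  rw [hx, h0] at this
  exact CStarRing.star_mul_self_eq_zero_iff x |>.mp (le_antisymm this (star_mul_self_nonneg x))

/-- In the commutative product, `x² = 0` forces the self-adjoint element `x⋆x` to have square zero,
so `x⋆x = 0` and then `x = 0`. -/
theorem eq_zero_of_map_mul_self (h : IsSchwarzProjection φ)
    (hcomm : ∀ x y, φ x = x → φ y = y → φ (x * y) = φ (y * x)) {x : A} (hx : φ x = x)
    (h0 : φ (x * x) = 0) : x = 0 := by
  have hxs : φ (star x) = star x := by rw [h.map_star, hx]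
  refine h.eq_zero_of_map_star_mul_self hx ?_
  refine h.eq_zero_of_map_star_mul_self (h.idem _) ?_
  rw [← h.map_star, star_mul, star_star, h.map_map_mul _ (h.idem _), hcomm _ _ hxs hx, mul_assoc,
    ← h.map_mul_map _ hxs, h.map_mul_map _ hx, ← mul_assoc, ← h.map_map_mul _ hxs, h0, zero_mul,
    map_zero, mul_zero, map_zero]

open scoped ComplexOrder in
theorem _root_.Complex.nonneg_of_smul_nonneg {c : ℂ} {e : A} (he : 0 ≤ e) (he0 : e ≠ 0)
    (h : 0 ≤ c • e) : 0 ≤ c := by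
  have hc : star c = c := by
    have h1 : star (c • e) = c • e := h.isSelfAdjoint
    rw [star_smul, show star e = e from he.isSelfAdjoint] at h1
    exact smul_left_injective ℂ he0 h1
  obtain ⟨r, rfl⟩ := Complex.conj_eq_iff_real.mp hc
  rw [Complex.coe_smul] at h
  rw [Complex.zero_le_real]
  by_contra! hr
  have h2 := smul_nonneg (neg_nonneg.mpr hr.le) he
  rw [neg_smul, neg_nonneg] at h2
  exact (smul_ne_zero hr.ne he0) (le_antisymm h2 h)

open scoped ComplexOrder in
/-- A Schwarz projection whose range is commutative for the Choi–Effros product factors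
positively through a finite-dimensional commutative algebra. -/
theorem exists_positive_decomposition [FiniteDimensional ℂ A] (h : IsSchwarzProjection φ)
    (hcomm : ∀ x y, φ x = x → φ y = y → φ (x * y) = φ (y * x)) :
    ∃ (m : ℕ) (p : Fin m → A) (f : Fin m → A →ₗ[ℂ] ℂ), (∀ i, 0 ≤ p i) ∧
      (∀ i x, 0 ≤ x → 0 ≤ f i x) ∧ ∀ x, φ x = ∑ i, f i x • p i := by
  have hr (x : LinearMap.range φ) : φ x = x := by
    obtain ⟨_, y, rfl⟩ := x
    exact h.idem y
  let _ : CommRing (LinearMap.range φ) := h.commRing hcomm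
  have hmul (x y : LinearMap.range φ) : ((x * y : LinearMap.range φ) : A) = φ (x * y) := rfl
  let _ : Algebra ℂ (LinearMap.range φ) := Algebra.ofModule
    (fun c x y => Subtype.ext <| by simp [hmul])
    (fun c x y => Subtype.ext <| by simp [hmul])
  have : IsReduced (LinearMap.range φ) := by
    rw [isReduced_iff_pow_one_lt 2 one_lt_two]
    intro x hx
    refine Subtype.ext (h.eq_zero_of_map_mul_self hcomm (hr x) ?_)
    rw [← hmul, ← sq, hx]
    rfl
  obtain ⟨m, e, χ, he, hχ, hsum⟩ := exists_idempotents_characters (LinearMap.range φ)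
  let s (x : LinearMap.range φ) : LinearMap.range φ := ⟨star x, star x, by rw [h.map_star, hr]⟩
  -- The value at an idempotent is 0 or 1; 0 would make `e⋆e` vanish in the new product.
  have hs (i : Fin m) : χ i (s (e i)) = 1 := by
    have hidem : IsIdempotentElem (s (e i)) := by
      refine Subtype.ext ?_
      have := congrArg (fun x : LinearMap.range φ => star (x : A)) (he i).2.eq
      simp only [hmul, ← h.map_star, star_mul] at this
      exact this
    refine (IsIdempotentElem.iff_eq_zero_or_one.mp (hidem.map (χ i))).resolve_left fun h0 => (he i).1 ?_
    have h1 := hχ i (s (e i))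
    rw [h0, zero_smul] at h1
    exact Subtype.ext (h.eq_zero_of_map_star_mul_self (hr _) (congrArg Subtype.val h1))
  have hp (i : Fin m) : 0 ≤ (e i : A) := by
    have h1 := congrArg Subtype.val (hχ i (s (e i)))
    rw [hs, one_smul, hmul] at h1
    rw [← h1]
    exact h.map_nonneg (star_mul_self_nonneg _)
  have hstar (i : Fin m) : star (e i : A) = e i := (hp i).isSelfAdjoint
  -- Compressing `x` by `e i` in the new product yields `χ i x • e i`, which is therefore
  -- nonnegative.
  have hpos (i : Fin m) (x : LinearMap.range φ) (hx : 0 ≤ (x : A)) : 0 ≤ χ i x := by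
    have h1 : (χ i x • e i : A) = φ (star (e i : A) * x * e i) := by
      have h2 : e i * x * e i = χ i x • e i := by
        rw [mul_assoc, hχ, mul_smul_comm, (he i).2.eq]
      rw [hstar, ← h.map_map_mul _ (hr _), ← hmul, ← hmul, h2]
      rfl
    have h3 : 0 ≤ χ i x • (e i : A) := by
      rw [h1]
      exact h.map_nonneg (star_left_conjugate_nonneg hx _)
    exact Complex.nonneg_of_smul_nonneg (hp i) (fun h0 => (he i).1 (Subtype.ext h0)) h3
  exact ⟨m, fun i => e i, fun i => (χ i).toLinearMap ∘ₗ φ.rangeRestrict, hp,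
    fun i x hx => hpos i _ (h.map_nonneg hx), fun x => by
      simpa using congrArg Subtype.val (hsum (φ.rangeRestrict x))⟩

end IsSchwarzProjection

/-! ### Matrices, transposition and separability. -/

section Matrix

open scoped MatrixOrder Matrix.Norms.L2Operator ComplexOrder

theorem isSchwarzProjection_of_isCompletelyPositive {n : ℕ}
    {φ : Matrix (Fin n) (Fin n) ℂ →ₗ[ℂ] Matrix (Fin n) (Fin n) ℂ}
    (hidem : φ ∘ₗ φ = φ) (hunital : φ 1 = 1) (hφ : IsCompletelyPositive φ) :
    IsSchwarzProjection φ := by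
  obtain ⟨Φ, rfl⟩ := hφ
  exact ⟨hunital, fun x => map_star Φ x, fun x => LinearMap.congr_fun hidem x,
    Φ.star_mul_self_le hunital⟩

/-- Transposing the Schwarz inequality for `T ∘ φ` preserves the order but reverses the product. -/
theorem IsPPT.mul_star_le {p q : ℕ}
    {φ : Matrix (Fin p) (Fin p) ℂ →ₗ[ℂ] Matrix (Fin q) (Fin q) ℂ}
    (hφ : IsPPT φ) (hunital : φ 1 = 1) (x : Matrix (Fin p) (Fin p) ℂ) :
    φ x * star (φ x) ≤ φ (star x * x) := by
  obtain ⟨Ψ, hΨ⟩ := hφ.2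
  have hΨ' (y : Matrix (Fin p) (Fin p) ℂ) : Ψ y = (φ y).transpose := LinearMap.congr_fun hΨ y
  have h := Ψ.star_mul_self_le (by rw [hΨ', hunital, Matrix.transpose_one]) x
  rw [hΨ', hΨ', Matrix.le_iff] at h
  rw [Matrix.le_iff]
  have := h.transpose
  rwa [Matrix.transpose_sub, Matrix.transpose_mul, Matrix.transpose_transpose,
    Matrix.transpose_transpose, show (star (φ x).transpose).transpose = star (φ x) from rfl] at this

theorem posSemidef_map_of_nonneg {k p : ℕ} {f : Matrix (Fin p) (Fin p) ℂ →ₗ[ℂ] ℂ}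
    (hf : ∀ x, 0 ≤ x → 0 ≤ f x) {X : Matrix (Fin k × Fin p) (Fin k × Fin p) ℂ}
    (hX : X.PosSemidef) :
    (((Matrix.comp (Fin k) (Fin k) (Fin p) (Fin p) ℂ).symm X).map f).PosSemidef := by
  let F : Matrix (Fin p) (Fin p) ℂ →ₚ[ℂ] ℂ := PositiveLinearMap.mk₀ f hf
  have hF (x : Matrix (Fin p) (Fin p) ℂ) : f (star x) = star (f x) := map_star F x
  refine .of_dotProduct_mulVec_nonneg ?_ fun v => ?_
  · ext a b
    rw [Matrix.conjTranspose_apply, Matrix.map_apply, Matrix.map_apply, ← hF]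
    congr 1
    ext i j
    exact hX.isHermitian.apply _ _
  -- `V = v ⊗ 1`, so that the quadratic form at `v` is `f` of the positive matrix `V⋆XV`.
  · let V : Matrix (Fin k × Fin p) (Fin p) ℂ := .of fun a i => if a.2 = i then v a.1 else 0
    have hV : V.conjTranspose * X * V = ∑ a, ∑ b, (star (v a) * v b) •
        (Matrix.comp (Fin k) (Fin k) (Fin p) (Fin p) ℂ).symm X a b := by
      ext i j
      simp [V, Matrix.mul_apply, Matrix.sum_apply, Fintype.sum_prod_type, Finset.sum_mul,
        apply_ite, ite_mul]
      rw [Finset.sum_comm]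
      refine Finset.sum_congr rfl fun a _ => Finset.sum_congr rfl fun b _ => ?_
      ring
    have h := hf _ (hX.conjTranspose_mul_mul_same V).nonneg
    rw [hV] at h
    simpa [dotProduct, Matrix.mulVec, Finset.mul_sum, mul_assoc, mul_comm, mul_left_comm] using h

theorem isEntanglementBreaking_of_decomposition {p q m : ℕ}
    {φ : Matrix (Fin p) (Fin p) ℂ →ₗ[ℂ] Matrix (Fin q) (Fin q) ℂ}
    {P : Fin m → Matrix (Fin q) (Fin q) ℂ} {f : Fin m → Matrix (Fin p) (Fin p) ℂ →ₗ[ℂ] ℂ}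
    (hP : ∀ i, 0 ≤ P i) (hf : ∀ i x, 0 ≤ x → 0 ≤ f i x) (hφ : ∀ x, φ x = ∑ i, f i x • P i) :
    IsEntanglementBreaking φ := by
  intro k X hX
  refine ⟨m, fun i => ((Matrix.comp (Fin k) (Fin k) (Fin p) (Fin p) ℂ).symm X).map (f i), P,
    fun i => posSemidef_map_of_nonneg (hf i) hX, fun i => Matrix.nonneg_iff_posSemidef.mp (hP i), ?_⟩
  ext ⟨a, b⟩ ⟨c, d⟩
  change φ _ b d = _
  rw [hφ]
  simp [Matrix.sum_apply]

end Matrix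

end PPT

theorem mainTheorem5 (n : ℕ)
    (φ : Matrix (Fin n) (Fin n) ℂ →ₗ[ℂ] Matrix (Fin n) (Fin n) ℂ)
    (hidem : φ ∘ₗ φ = φ) (hunital : φ 1 = 1) (hPPT : PPT.IsPPT φ) :
    PPT.IsEntanglementBreaking φ := by
  open scoped MatrixOrder Matrix.Norms.L2Operator in
  have h := PPT.isSchwarzProjection_of_isCompletelyPositive hidem hunital hPPT.1
  obtain ⟨m, P, f, hP, hf, hφ⟩ := h.exists_positive_decomposition fun x y hx hy =>
    h.map_mul_comm (fun z hz => by
      have := h.map_mono (hPPT.mul_star_le hunital z)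
      rwa [hz, h.idem] at this) hx hy
  exact PPT.isEntanglementBreaking_of_decomposition hP hf hφ
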